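/- **Impulsive systems.** A semidynamical system on a metric space $X$ is a continuous map $\pi:X\times\mathbb R_+\to X$ with $\pi(x,0)=x$ and $\pi(\pi(x,t),s)=\pi(x,t+s)$. Write $F(D,\Delta)=\{z\in X:\pi(z,t)\in D\text{ for some }t\in\Delta\}$. An impulsive system $(X,\pi;M,I)$ consists of such a $\pi$, a nonempty closed set $M\subset X$ such that for every $x\in M$ there is $\epsilon_x>0$ with $F(\{x\},(0,\epsilon_x))\cap M=\emptyset$ and $\pi(x,(0,\epsilon_x))\cap M=\emptyset$, and a continuous map $I:M\to X$. Let $\phi(x)\in(0,\infty]$ be the least $s>0$ with $\pi(x,s)\in M$ ($\phi(x)=\infty$ if there is none). Put $x_0^+=x$, $t_0(x)=0$ and, as long as $\phi(x_n^+)<\infty$, $x_{n+1}^+=I(\pi(x_n^+,\phi(x_n^+)))$; put $t_{n+1}(x)=t_n(x)+\phi(x_n^+)$. The impulsive motion is $\tilde\pi(x,t)=\pi(x_n^+,t-t_n(x))$ for $t_n(x)\le t<t_{n+1}(x)$. It is assumed throughout that: - (H1) for every $x\in M$ there is $t>0$ with $F(\{x\},\{t\})\ne\emptyset$, and there are $\lambda>0$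 and closed sets $S\ni x$ and $L$ such that $F(L,\{\lambda\})=S$, $F(L,[0,2\lambda])$ is a neighbourhood of $x$, $F(L,\{\mu\})\cap F(L,\{\nu\})=\emptyset$ for $0\le\mu<\nu\le2\lambda$, and $S=M\cap F(L,[0,2\lambda])$; - (H2) $M\cap I(M)=\emptyset$; - (H3) $\tilde\pi(x,t)$ is defined for all $x\in X$ and $t\ge0$. Let $\tilde\pi^+(x)=\{\tilde\pi(x,t):t\ge0\}$, and let $\tilde L^+(x)$ be the set of all limits of sequences $\tilde\pi(x,t_n)$ with $t_n\to+\infty$. A point $p$ is *stationary* if $\tilde\pi(p,t)=p$ for all $t\ge0$; *periodic* if $\tilde\pi(p,\tau)=p$ for some $\tau>0$; *almost periodic* if for every $\epsilon>0$ there is $T>0$ such that every interval $[\alpha,\alpha+T]$ with $\alpha\ge0$ contains some $\tau>0$ with $\rho(\tilde\pi(p,t+\tau),\tilde\pi(p,t))<\epsilon$ for all $t\ge0$. A point $x$ is *asymptotically* stationary (periodic, almost periodic) if there are a stationary (periodic, almost periodic) point $p$ and a homeomorphism $g:\mathbb R_+\to\mathbb R_+$ with $g(0)=0$ such that $\rho(\tilde\pi(x,t),\tilde\pi(p,g(t)))\to0$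 as $t\to+\infty$. **Statement.** Let $(X,\pi;M_X,I_X)$ and $(Y,\sigma;M_Y,I_Y)$ be impulsive systems on metric spaces satisfying (H1)–(H3), with $Y$ complete. Let $h:X\to Y$ be an $I$-homomorphism: $h$ is continuous, $h(\tilde\pi(z,t))=\tilde\sigma(h(z),t)$ for all $z\in X\setminus M_X$ and $t\ge0$, and $h(\tilde\pi(I_X(z),t))=\tilde\sigma(h(I_X(z)),t)$ for all $z\in M_X$ and $t\ge0$. Let $y\in Y$ and $x\in X_y\setminus M_X$, where $X_y=h^{-1}(\{y\})$, be such that $\overline{\tilde\pi^+(x)}$ is compact, and suppose that for each $q\in\tilde L^+_Y(y)$ there is a unique $p\in X$ with $h(p)=q$. Then: 1. if $y$ is asymptotically almost periodic (for $\tilde\sigma$), then $x$ is asymptotically almost periodic (for $\tilde\pi$); 2. if $y$ is asymptotically stationary, then $x$ is asymptotically stationary; 3. if $y$ is asymptotically periodic, then $x$ is asymptotically periodic. -/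

import Mathlib

open Set Filter Topology
open scoped NNReal ENNReal

/-- `flowPre π D Δ` is the set `F(D, Δ)` of all points that the semidynamical system `π` carries
into `D` at some time of `Δ`. (A semidynamical system is a `Flow` with time monoid `ℝ≥0`.) -/
def flowPre {X : Type*} [TopologicalSpace X] (π : Flow ℝ≥0 X) (D : Set X) (Δ : Set ℝ≥0) : Set X :=
  {z | ∃ t ∈ Δ, π t z ∈ D}

/-- An initial point: no point reaches `x` in positive time. -/
def IsInitialPoint {X : Type*} [TopologicalSpace X] (π : Flow ℝ≥0 X) (x : X) : Prop :=
  ∀ t : ℝ≥0, 0 < t → flowPre π {x} {t} = ∅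

/-- `S` is a `l`-section through `x` with bar `L`. -/
structure IsSection {X : Type*} [TopologicalSpace X] (π : Flow ℝ≥0 X) (x : X) (l : ℝ≥0)
    (S L : Set X) : Prop where
  pos : 0 < l
  isClosed_section : IsClosed S
  mem : x ∈ S
  isClosed_bar : IsClosed L
  pre_eq : flowPre π L {l} = S
  tube_nhds : flowPre π L (Icc 0 (2 * l)) ∈ 𝓝 x
  disjoint : ∀ m n : ℝ≥0, m < n → n ≤ 2 * l → flowPre π L {m} ∩ flowPre π L {n} = ∅

/-- The strong tube condition (STC) at `x` relative to the set `M`. -/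
def StrongTubeCondition {X : Type*} [TopologicalSpace X] (π : Flow ℝ≥0 X) (M : Set X) (x : X) :
    Prop :=
  ∃ (l : ℝ≥0) (S L : Set X), IsSection π x l S L ∧ S = M ∩ flowPre π L (Icc 0 (2 * l))

/-- An impulsive semidynamical system `(X, π; M, I)`. The impulse function is a map `M → X`; it is
recorded as a total function of which only the values on `M` are constrained and used. -/
structure ImpulsiveSystem (X : Type*) [MetricSpace X] where
  flow : Flow ℝ≥0 X
  M : Set X
  nonempty : M.Nonempty
  isClosed : IsClosed M
  isolated : ∀ x ∈ M, ∃ ε : ℝ≥0, 0 < ε ∧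
    flowPre flow {x} (Ioo 0 ε) ∩ M = ∅ ∧ ∀ t ∈ Ioo 0 ε, flow t x ∉ M
  I : X → X
  continuousOn : ContinuousOn I M

namespace ImpulsiveSystem

/-- `φ(x)`: the least positive time at which the `π`-trajectory of `x` meets `M`, and `∞` if there
is none. -/
noncomputable def phi {X : Type*} [MetricSpace X] (S : ImpulsiveSystem X) (x : X) : ℝ≥0∞ :=
  ⨅ (s : ℝ≥0) (_ : 0 < s ∧ S.flow s x ∈ S.M), (s : ℝ≥0∞)

/-- `xₙ⁺`: `x₀⁺ = x` and `xₙ₊₁⁺ = I(π(xₙ⁺, φ(xₙ⁺)))`. The value is meaningless, and never used,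
once `φ(xₙ⁺) = ∞` has occurred. -/
noncomputable def impulsePoint {X : Type*} [MetricSpace X] (S : ImpulsiveSystem X) (x : X) : ℕ → X
  | 0 => x
  | n + 1 => S.I (S.flow (S.phi (S.impulsePoint x n)).toNNReal (S.impulsePoint x n))

/-- `tₙ(x) = φ(x₀⁺) + ⋯ + φ(xₙ₋₁⁺)`, the time of the `n`-th impulse (`∞` if it never happens). -/
noncomputable def impulseTime {X : Type*} [MetricSpace X] (S : ImpulsiveSystem X) (x : X) (n : ℕ) :
    ℝ≥0∞ :=
  ∑ i ∈ Finset.range n, S.phi (S.impulsePoint x i)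

/-- `T(x)`: the impulsive trajectory of `x` is defined on `[0, T(x))`. -/
noncomputable def lifetime {X : Type*} [MetricSpace X] (S : ImpulsiveSystem X) (x : X) : ℝ≥0∞ :=
  ⨆ n, S.impulseTime x n

open Classical in
/-- The impulsive motion `π̃(x, t)`: equal to `π(xₙ⁺, t - tₙ(x))` for `tₙ(x) ≤ t < tₙ₊₁(x)`.
For `t ≥ T(x)`, where it is undefined, it takes the dummy value `x`. -/
noncomputable def traj {X : Type*} [MetricSpace X] (S : ImpulsiveSystem X) (x : X) (t : ℝ≥0) : X :=
  if H : ∃ n, (t : ℝ≥0∞) < S.impulseTime x (n + 1) then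
    S.flow (t - (S.impulseTime x (Nat.find H)).toNNReal) (S.impulsePoint x (Nat.find H))
  else x

/-- The impulsive positive orbit. -/
def orbit {X : Type*} [MetricSpace X] (S : ImpulsiveSystem X) (x : X) : Set X :=
  {z | ∃ t : ℝ≥0, (t : ℝ≥0∞) < S.lifetime x ∧ S.traj x t = z}

/-- The standing conditions (H1), (H2), (H3). -/
structure Standing {X : Type*} [MetricSpace X] (S : ImpulsiveSystem X) : Prop where
  not_initial : ∀ x ∈ S.M, ¬ IsInitialPoint S.flow x
  strongTube : ∀ x ∈ S.M, StrongTubeCondition S.flow S.M x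
  disjoint : S.M ∩ S.I '' S.M = ∅
  global : ∀ x, S.lifetime x = ∞

/-- The positive limit set `L̃⁺(x)`. -/
def limitSet {X : Type*} [MetricSpace X] (S : ImpulsiveSystem X) (x : X) : Set X :=
  {z | ∃ u : ℕ → ℝ≥0, Tendsto u atTop atTop ∧ Tendsto (fun n => S.traj x (u n)) atTop (𝓝 z)}

def IsStationary {X : Type*} [MetricSpace X] (S : ImpulsiveSystem X) (x : X) : Prop :=
  ∀ t : ℝ≥0, S.traj x t = x

def IsPeriodic {X : Type*} [MetricSpace X] (S : ImpulsiveSystem X) (x : X) : Prop :=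
  ∃ τ : ℝ≥0, 0 < τ ∧ S.traj x τ = x

def IsAlmostPeriodic {X : Type*} [MetricSpace X] (S : ImpulsiveSystem X) (x : X) : Prop :=
  ∀ ε : ℝ, 0 < ε → ∃ T : ℝ≥0, 0 < T ∧ ∀ α : ℝ≥0, ∃ τ ∈ Icc α (α + T), 0 < τ ∧
    ∀ t : ℝ≥0, dist (S.traj x (t + τ)) (S.traj x t) < ε

/-- The motion of `x` is asymptotic to the motion of `p` up to a time reparametrization. -/
def AsymptoticTo {X : Type*} [MetricSpace X] (S : ImpulsiveSystem X) (x p : X) : Prop :=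
  ∃ g : ℝ≥0 ≃ₜ ℝ≥0, g 0 = 0 ∧
    Tendsto (fun t : ℝ≥0 => dist (S.traj x t) (S.traj p (g t))) atTop (𝓝 0)

def IsAsympStationary {X : Type*} [MetricSpace X] (S : ImpulsiveSystem X) (x : X) : Prop :=
  ∃ p, S.IsStationary p ∧ S.AsymptoticTo x p

def IsAsympPeriodic {X : Type*} [MetricSpace X] (S : ImpulsiveSystem X) (x : X) : Prop :=
  ∃ p, S.IsPeriodic p ∧ S.AsymptoticTo x p

def IsAsympAlmostPeriodic {X : Type*} [MetricSpace X] (S : ImpulsiveSystem X) (x : X) : Prop :=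
  ∃ p, S.IsAlmostPeriodic p ∧ S.AsymptoticTo x p

/-- `h` is an `I`-homomorphism from the impulsive system `S` to the impulsive system `R`. -/
structure IsIHomomorphism {X Y : Type*} [MetricSpace X] [MetricSpace Y] (S : ImpulsiveSystem X)
    (R : ImpulsiveSystem Y) (h : X → Y) : Prop where
  continuous : Continuous h
  map_traj : ∀ x ∉ S.M, ∀ t : ℝ≥0, h (S.traj x t) = R.traj (h x) t
  map_traj_impulse : ∀ x ∈ S.M, ∀ t : ℝ≥0, h (S.traj (S.I x) t) = R.traj (h (S.I x)) t

end ImpulsiveSystem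

/-! Over the limit set of `y` the map `h` is injective, and compactness of the orbit closure of `x`
makes it a bijection from the limit set of `x` onto that of `y` with uniformly continuous inverse.
If `y` is asymptotic to an almost periodic `q`, the whole trajectory of `q` recurs, hence lies in
the limit set of `y`, and it can be lifted point by point.

The lifted points form an impulsive trajectory only if the starting point `p` is off `S.M`, since
`h` commutes with the motions only there. Such a `p` exists: (H2) and the isolation of impacts
prevent the limit set of `x` from lying inside `S.M`, and the lifts of the trajectory of `q` are
dense in that limit set. So `p` lies over a later point of the trajectory of `q`.

Uniform continuity of the inverse then transfers almost periods from `q` to `p`, injectivity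
transfers coincidences of positions (so stationarity and periods), and a compactness argument
transfers the asymptotics. -/

namespace ImpulsiveSystem

variable {X : Type*} [MetricSpace X] (S : ImpulsiveSystem X)

/-! ### First impact time. -/

theorem phi_le {z : X} {s : ℝ≥0} (hs : 0 < s) (h : S.flow s z ∈ S.M) : S.phi z ≤ s :=
  iInf₂_le s ⟨hs, h⟩

theorem le_phi {z : X} {c : ℝ≥0∞} (h : ∀ s : ℝ≥0, 0 < s → S.flow s z ∈ S.M → c ≤ s) :
    c ≤ S.phi z :=
  le_iInf₂ fun s hs => h s hs.1 hs.2

theorem exists_pos_flow_notMem (z : X) :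
    ∃ ε : ℝ≥0, 0 < ε ∧ ∀ s : ℝ≥0, 0 < s → s < ε → S.flow s z ∉ S.M := by
  by_cases hz : z ∈ S.M
  · obtain ⟨ε, hε, -, h⟩ := S.isolated z hz
    exact ⟨ε, hε, fun s h1 h2 => h s ⟨h1, h2⟩⟩
  · have hc : Continuous fun s : ℝ≥0 => S.flow s z :=
      S.flow.continuous continuous_id continuous_const
    have h0 : ∀ᶠ s : ℝ≥0 in 𝓝 0, S.flow s z ∉ S.M := by
      have h1 : S.Mᶜ ∈ 𝓝 (S.flow 0 z) := S.isClosed.isOpen_compl.mem_nhds (by simpa using hz)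
      exact hc.continuousAt h1
    obtain ⟨ε, hε, h⟩ := NNReal.nhds_zero_basis.mem_iff.1 h0
    exact ⟨ε, hε, fun s _ h2 => h h2⟩

theorem phi_pos (z : X) : 0 < S.phi z := by
  obtain ⟨ε, hε, h⟩ := S.exists_pos_flow_notMem z
  refine lt_of_lt_of_le (ENNReal.coe_pos.2 hε) (S.le_phi fun s hs hM => ?_)
  by_contra hlt
  exact h s hs (by exact_mod_cast not_le.1 hlt) hM

/-- A finite first impact time is attained. -/
theorem flow_phi_mem {z : X} (hz : S.phi z ≠ ∞) : S.flow (S.phi z).toNNReal z ∈ S.M := by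
  obtain ⟨ε, hε, h⟩ := S.exists_pos_flow_notMem z
  set H : Set ℝ≥0 := {s | ε ≤ s ∧ S.flow s z ∈ S.M} with hH
  have hc : Continuous fun s : ℝ≥0 => S.flow s z :=
    S.flow.continuous continuous_id continuous_const
  have hcl : IsClosed H := isClosed_Ici.inter (S.isClosed.preimage hc)
  have hle : ∀ s, 0 < s → S.flow s z ∈ S.M → s ∈ H := fun s hs hM =>
    ⟨not_lt.1 fun hlt => h s hs hlt hM, hM⟩
  have hne : H.Nonempty := by
    by_contra hne
    apply hz
    rw [eq_top_iff]
    exact S.le_phi fun s hs hM => absurd ⟨s, hle s hs hM⟩ hne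
  have hleast := hcl.isLeast_csInf hne (OrderBot.bddBelow H)
  have : S.phi z = (sInf H : ℝ≥0) :=
    le_antisymm (S.phi_le (hε.trans_le hleast.1.1) hleast.1.2)
      (S.le_phi fun s hs hM => by exact_mod_cast hleast.2 (hle s hs hM))
  rw [this, ENNReal.toNNReal_coe]
  exact hleast.1.2

theorem phi_flow_add {z : X} {r : ℝ≥0} (hr : (r : ℝ≥0∞) < S.phi z) :
    S.phi (S.flow r z) + r = S.phi z := by
  apply le_antisymm
  · refine S.le_phi fun s hs hM => ?_
    have hrs : r < s := by exact_mod_cast hr.trans_le (S.phi_le hs hM)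
    have h1 : S.phi (S.flow r z) ≤ (s - r : ℝ≥0) := by
      apply S.phi_le (tsub_pos_of_lt hrs)
      rwa [← Flow.map_add, tsub_add_cancel_of_le hrs.le]
    calc S.phi (S.flow r z) + r ≤ (s - r : ℝ≥0) + r := by gcongr
      _ = s := by rw [← ENNReal.coe_add, tsub_add_cancel_of_le hrs.le]
  · by_cases ht : S.phi (S.flow r z) = ∞
    · simp [ht]
    · have hM := S.flow_phi_mem ht
      have hp : 0 < (S.phi (S.flow r z)).toNNReal :=
        ENNReal.toNNReal_pos (S.phi_pos _).ne' ht
      rw [← Flow.map_add] at hM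
      have := S.phi_le (add_pos_of_pos_of_nonneg hp (zero_le : 0 ≤ r)) hM
      rwa [ENNReal.coe_add, ENNReal.coe_toNNReal ht] at this

/-! ### Impulse times and the semigroup law of the impulsive motion. -/

theorem impulseTime_zero (x : X) : S.impulseTime x 0 = 0 := by simp [impulseTime]

theorem impulseTime_succ (x : X) (n : ℕ) :
    S.impulseTime x (n + 1) = S.impulseTime x n + S.phi (S.impulsePoint x n) := by
  simp [impulseTime, Finset.sum_range_succ]

theorem impulseTime_mono (x : X) : Monotone (S.impulseTime x) :=
  monotone_nat_of_le_succ fun n => by rw [impulseTime_succ]; exact le_self_add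

theorem traj_eq {x : X} {t : ℝ≥0} {n : ℕ} (h1 : S.impulseTime x n ≤ t)
    (h2 : t < S.impulseTime x (n + 1)) :
    S.traj x t = S.flow (t - (S.impulseTime x n).toNNReal) (S.impulsePoint x n) := by
  classical
  have H : ∃ n, (t : ℝ≥0∞) < S.impulseTime x (n + 1) := ⟨n, h2⟩
  have hn : Nat.find H = n := by
    rw [Nat.find_eq_iff]
    exact ⟨h2, fun m hm => not_lt.2 ((S.impulseTime_mono x hm).trans h1)⟩
  rw [traj, dif_pos H]
  convert rfl using 3 <;> first | exact hn.symm | rw [← hn]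

theorem traj_of_lt_phi {x : X} {t : ℝ≥0} (h : t < S.phi x) : S.traj x t = S.flow t x := by
  have := S.traj_eq (x := x) (t := t) (n := 0) (by simp [impulseTime_zero])
    (by simpa [impulseTime_succ, impulseTime_zero, impulsePoint] using h)
  simpa [impulseTime_zero, impulsePoint] using this

theorem traj_zero (x : X) : S.traj x 0 = x := by
  rw [S.traj_of_lt_phi (by simpa using S.phi_pos x), Flow.map_zero_apply]

theorem traj_phi {x : X} (h : S.phi x ≠ ∞) :
    S.traj x (S.phi x).toNNReal = S.I (S.flow (S.phi x).toNNReal x) := by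
  have h1 : S.impulseTime x 1 = S.phi x := by
    simp [impulseTime_succ, impulseTime_zero, impulsePoint]
  have := S.traj_eq (x := x) (t := (S.phi x).toNNReal) (n := 1)
    (by rw [h1, ENNReal.coe_toNNReal h])
    (by rw [impulseTime_succ, h1, ENNReal.coe_toNNReal h]
        exact ENNReal.lt_add_right h (S.phi_pos _).ne')
  rw [this, h1, tsub_self, Flow.map_zero_apply]
  rfl

theorem exists_impulseTime_le_lt {x : X} (hx : S.lifetime x = ∞) (t : ℝ≥0) :
    ∃ n, S.impulseTime x n ≤ t ∧ t < S.impulseTime x (n + 1) := by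
  classical
  have H : ∃ n, (t : ℝ≥0∞) < S.impulseTime x (n + 1) := by
    have : (t : ℝ≥0∞) < ⨆ n, S.impulseTime x n := by
      rw [← lifetime, hx]; exact ENNReal.coe_lt_top
    obtain ⟨n, hn⟩ := lt_iSup_iff.1 this
    exact ⟨n, hn.trans_le (S.impulseTime_mono x n.le_succ)⟩
  refine ⟨Nat.find H, ?_, Nat.find_spec H⟩
  rcases hf : Nat.find H with _ | m
  · simp [impulseTime_zero]
  · exact not_lt.1 (Nat.find_min H (m := m) (by omega))

/-- Restarting inside the `n`-th continuous piece: later impulse times are shifted. -/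
theorem restart {w : X} {r : ℝ≥0} (hr : (r : ℝ≥0∞) < S.phi w)
    {x : X} {n : ℕ} (hw : S.impulsePoint x n = w)
    -- Indices start at `m + 1`: the restarted motion begins at `S.flow r w` rather than `w`, and
    -- the two sequences of impulse points agree only from the next impact on.
    (m : ℕ) (hm : S.impulseTime (S.flow r w) (m + 1) ≠ ∞) :
    S.impulsePoint (S.flow r w) (m + 1) = S.impulsePoint x (n + (m + 1)) ∧
    S.impulseTime (S.flow r w) (m + 1) + (S.impulseTime x n + r) =
      S.impulseTime x (n + (m + 1)) := by
  induction m with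
  | zero =>
    have h1 : S.impulseTime (S.flow r w) 1 = S.phi (S.flow r w) := by
      simp [impulseTime_succ, impulseTime_zero, impulsePoint]
    have hphi := S.phi_flow_add hr
    rw [zero_add, h1] at hm
    constructor
    · change S.I (S.flow (S.phi (S.flow r w)).toNNReal (S.flow r w)) =
        S.I (S.flow (S.phi (S.impulsePoint x n)).toNNReal (S.impulsePoint x n))
      rw [hw, ← hphi, ENNReal.toNNReal_add hm ENNReal.coe_ne_top, ENNReal.toNNReal_coe,
        Flow.map_add]
    · rw [zero_add, h1, impulseTime_succ, hw, ← hphi]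
      ring
  | succ m ih =>
    have hm' : S.impulseTime (S.flow r w) (m + 1) ≠ ∞ :=
      ne_top_of_le_ne_top hm (S.impulseTime_mono _ (m + 1).le_succ)
    obtain ⟨i1, i2⟩ := ih hm'
    constructor
    · change S.I (S.flow (S.phi (S.impulsePoint (S.flow r w) (m + 1))).toNNReal
        (S.impulsePoint (S.flow r w) (m + 1))) =
        S.I (S.flow (S.phi (S.impulsePoint x (n + (m + 1)))).toNNReal
        (S.impulsePoint x (n + (m + 1))))
      rw [i1]
    · rw [S.impulseTime_succ _ (m + 1), ← add_assoc n, S.impulseTime_succ _ (n + (m + 1)), ← i2, i1]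
      ring

/-- The semigroup property of the impulsive motion. -/
theorem traj_traj (hS : ∀ x, S.lifetime x = ∞) (x : X) (s t : ℝ≥0) :
    S.traj (S.traj x s) t = S.traj x (s + t) := by
  obtain ⟨n, h1, h2⟩ := S.exists_impulseTime_le_lt (hS x) s
  have hn : S.impulseTime x n ≠ ∞ := ne_top_of_le_ne_top ENNReal.coe_ne_top h1
  obtain ⟨a, ha⟩ := WithTop.ne_top_iff_exists.1 hn
  change (a : ℝ≥0∞) = _ at ha
  rw [S.traj_eq h1 h2]
  rw [← ha] at h1
  have has : a ≤ s := by exact_mod_cast h1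
  obtain ⟨r, rfl⟩ := exists_add_of_le has
  have hr : (r : ℝ≥0∞) < S.phi (S.impulsePoint x n) := by
    rw [impulseTime_succ, ← ha, ENNReal.coe_add] at h2
    exact (ENNReal.add_lt_add_iff_left ENNReal.coe_ne_top).1 h2
  rw [← ha, ENNReal.toNNReal_coe, add_tsub_cancel_left]
  set w := S.impulsePoint x n with hw
  obtain ⟨m, m1, m2⟩ := S.exists_impulseTime_le_lt (hS (S.flow r w)) t
  have key := S.restart hr hw.symm
  have hlast : (a + r + t : ℝ≥0) < S.impulseTime x (n + (m + 1)) := by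
    by_cases hT : S.impulseTime (S.flow r w) (m + 1) = ∞
    · rcases m with _ | m
      · rw [zero_add] at hT
        have hphi : S.phi w = ∞ := by
          rw [← S.phi_flow_add hr]
          simpa [impulseTime_succ, impulseTime_zero, impulsePoint] using hT
        rw [zero_add, impulseTime_succ, ← hw, hphi, add_top]
        exact ENNReal.coe_lt_top
      · obtain ⟨k1, k2⟩ := key m (ne_top_of_le_ne_top ENNReal.coe_ne_top m1)
        rw [impulseTime_succ, k1, ENNReal.add_eq_top] at hT
        have hT' := hT.resolve_left (ne_top_of_le_ne_top ENNReal.coe_ne_top m1)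
        rw [← add_assoc, impulseTime_succ, hT', add_top]
        exact ENNReal.coe_lt_top
    · obtain ⟨-, k2⟩ := key m hT
      rw [← k2, ← ha, ENNReal.coe_add (a + r) t, ENNReal.coe_add, add_comm]
      exact (ENNReal.add_lt_add_iff_right
        (ENNReal.add_ne_top.2 ⟨ENNReal.coe_ne_top, ENNReal.coe_ne_top⟩)).2 m2
  rw [S.traj_eq m1 m2]
  -- Before the first impact after the restart, `key` says nothing and the semigroup law of the flow
  -- suffices.
  rcases m with _ | m
  · rw [S.traj_eq (n := n) (x := x) _ (by simpa using hlast)]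
    · rw [← ha, impulseTime_zero, ← hw]
      simp only [ENNReal.toNNReal_zero, tsub_zero, ENNReal.toNNReal_coe, impulsePoint]
      rw [add_assoc, add_tsub_cancel_left, ← Flow.map_add, add_comm]
    · rw [← ha, add_assoc]
      exact_mod_cast le_self_add
  · have hT := ne_top_of_le_ne_top ENNReal.coe_ne_top m1
    obtain ⟨k1, k2⟩ := key m hT
    obtain ⟨b, hb⟩ := WithTop.ne_top_iff_exists.1 hT
    change (b : ℝ≥0∞) = _ at hb
    rw [← hb, ← ha] at k2
    rw [S.traj_eq (n := n + (m + 1)) (x := x) _ (by simpa [add_assoc] using hlast), k1, ← k2, ← hb]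
    · congr 1
      rw [← ENNReal.coe_add, ← ENNReal.coe_add, ENNReal.toNNReal_coe, ENNReal.toNNReal_coe,
        add_comm b, add_tsub_add_eq_tsub_left]
    · rw [← k2]
      rw [← hb] at m1
      have : b ≤ t := by exact_mod_cast m1
      rw [← ENNReal.coe_add, ← ENNReal.coe_add, ENNReal.coe_le_coe, add_comm b]
      gcongr

end ImpulsiveSystem


/-! ### Compactness and time reparametrization. -/

/-- If the distances of the images under `h` tend to `0` and `h` is injective over the images of
the cluster points of `a`, then the distances themselves tend to `0`. -/
theorem tendsto_dist_of_tendsto_dist_map {ι X Y : Type*} [MetricSpace X] [MetricSpace Y]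
    {h : X → Y} (hh : Continuous h) {K : Set X} (hK : IsCompact K) {l : Filter ι} {a b : ι → X}
    (ha : ∀ᶠ i in l, a i ∈ K) (hb : ∀ᶠ i in l, b i ∈ K)
    (hab : Tendsto (fun i => dist (h (a i)) (h (b i))) l (𝓝 0))
    (hinj : ∀ p, MapClusterPt p l a → ∀ p', h p = h p' → p = p') :
    Tendsto (fun i => dist (a i) (b i)) l (𝓝 0) := by
  rw [tendsto_iff_ultrafilter]
  -- Along an ultrafilter both families converge in `K`, so it suffices to compare two limit points
  -- with the same image.
  intro U hU
  obtain ⟨p, -, hp⟩ := hK.ultrafilter_le_nhds' (U.map a) (hU ha)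
  obtain ⟨q, -, hq⟩ := hK.ultrafilter_le_nhds' (U.map b) (hU hb)
  replace hp : Tendsto a U (𝓝 p) := hp
  replace hq : Tendsto b U (𝓝 q) := hq
  have h1 : Tendsto (fun i => dist (h (a i)) (h (b i))) U (𝓝 (dist (h p) (h q))) :=
    ((hh.tendsto p).comp hp).dist ((hh.tendsto q).comp hq)
  have h2 : h p = h q := dist_eq_zero.1 (tendsto_nhds_unique h1 (hab.mono_left hU))
  have h3 : p = q := hinj p (mapClusterPt_iff_ultrafilter.2 ⟨U, hU, hp⟩) q h2
  simpa [h3] using hp.dist hq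

/-- The homeomorphism of `ℝ≥0` which fixes `0` and is `u ↦ u - s` for large `u`. -/
noncomputable def shiftHomeomorph (s : ℝ≥0) : ℝ≥0 ≃ₜ ℝ≥0 where
  -- Slope `1/2` up to `u = 2 * s`, where both branches equal `s`, then slope `1`.
  toFun u := max (u / 2) (u - s)
  invFun v := min (2 * v) (v + s)
  left_inv u := by
    beta_reduce
    rcases le_total u (2 * s) with h | h
    · rw [max_eq_left, min_eq_left]
      · rw [← NNReal.coe_inj]; push_cast; ring
      · rw [← NNReal.coe_le_coe] at h ⊢; push_cast at h ⊢; linarith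
      · rw [tsub_le_iff_right]
        rw [← NNReal.coe_le_coe] at h ⊢; push_cast at h ⊢; linarith
    · have hs : s ≤ u := le_trans (by rw [two_mul]; exact le_self_add) h
      rw [max_eq_right, min_eq_right]
      · exact tsub_add_cancel_of_le hs
      · rw [← NNReal.coe_le_coe] at h ⊢; push_cast [NNReal.coe_sub hs] at h ⊢; linarith
      · rw [← NNReal.coe_le_coe] at h ⊢; push_cast [NNReal.coe_sub hs] at h ⊢; linarith
  right_inv v := by
    beta_reduce
    rcases le_total v s with h | h
    · rw [min_eq_left, max_eq_left]
      · rw [← NNReal.coe_inj]; push_cast; ring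
      · rw [tsub_le_iff_right]
        rw [← NNReal.coe_le_coe] at h ⊢; push_cast at h ⊢; linarith
      · rw [two_mul]; gcongr
    · rw [min_eq_right, max_eq_right]
      · exact add_tsub_cancel_right v s
      · rw [add_tsub_cancel_right]
        rw [← NNReal.coe_le_coe] at h ⊢; push_cast at h ⊢; linarith
      · rw [two_mul]; gcongr
  continuous_toFun := by fun_prop
  continuous_invFun := by fun_prop

theorem shiftHomeomorph_zero (s : ℝ≥0) : shiftHomeomorph s 0 = 0 := by
  simp [shiftHomeomorph]

theorem shiftHomeomorph_of_le {s u : ℝ≥0} (h : 2 * s ≤ u) : shiftHomeomorph s u = u - s := by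
  have hs : s ≤ u := le_trans (by rw [two_mul]; exact le_self_add) h
  refine max_eq_right ?_
  rw [← NNReal.coe_le_coe] at h ⊢; push_cast [NNReal.coe_sub hs] at h ⊢; linarith

theorem Homeomorph.tendsto_nnreal_atTop (g : ℝ≥0 ≃ₜ ℝ≥0) : Tendsto g atTop atTop := by
  simpa using g.isClosedEmbedding.tendsto_cocompact

namespace ImpulsiveSystem

variable {X : Type*} [MetricSpace X] {S : ImpulsiveSystem X}

/-! ### Limit sets, asymptotic motions and recurrence. -/

theorem mem_limitSet_iff {x z : X} : z ∈ S.limitSet x ↔ MapClusterPt z atTop (S.traj x) := by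
  constructor
  · rintro ⟨u, hu, hz⟩
    exact MapClusterPt.of_comp hu hz.mapClusterPt
  · intro hz
    obtain ⟨u, h1, h2⟩ := hz.exists_seq_tendsto
    exact ⟨u, h2, h1⟩

theorem mem_limitSet_of_tendsto {ι : Type*} {l : Filter ι} [NeBot l] {u : ι → ℝ≥0} {x z : X}
    (hu : Tendsto u l atTop) (hz : Tendsto (fun i => S.traj x (u i)) l (𝓝 z)) :
    z ∈ S.limitSet x :=
  mem_limitSet_iff.2 (MapClusterPt.of_comp hu hz.mapClusterPt)

theorem isClosed_limitSet (x : X) : IsClosed (S.limitSet x) := by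
  have : S.limitSet x = {z | ClusterPt z (map (S.traj x) atTop)} := by
    ext z; exact mem_limitSet_iff
  rw [this]
  exact isClosed_setOfPred_clusterPt

theorem traj_mem_orbit (hS : ∀ x, S.lifetime x = ∞) (x : X) (t : ℝ≥0) :
    S.traj x t ∈ S.orbit x :=
  ⟨t, by rw [hS]; exact ENNReal.coe_lt_top, rfl⟩

theorem limitSet_subset_closure_orbit (hS : ∀ x, S.lifetime x = ∞) (x : X) :
    S.limitSet x ⊆ closure (S.orbit x) := by
  rintro z ⟨u, -, hz⟩
  exact mem_closure_of_tendsto hz (Eventually.of_forall fun n => traj_mem_orbit hS x _)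

/-- A limit set contains a point off the impulsive set as soon as it is nonempty. -/
theorem exists_mem_limitSet_notMem (hS : S.Standing) {x p : X} (hp : p ∈ S.limitSet x) :
    ∃ z ∈ S.limitSet x, z ∉ S.M := by
  by_contra! hsub
  obtain ⟨U, hU, hUp⟩ := mapClusterPt_iff_ultrafilter.1 (mem_limitSet_iff.1 hp)
  obtain ⟨ε, hε, hfree⟩ := S.exists_pos_flow_notMem p
  have hε2 : ε / 2 < ε := NNReal.half_lt_self hε.ne'
  -- If impacts stay away, the limit set contains `S.flow (ε / 2) p`, which is off `S.M`. Otherwise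
  -- impact times accumulate at a time at most `ε / 2`, which must be `0`; then `p` is in `S.M` and
  -- `S.I p` is in the limit set, against (H2).
  rcases Ultrafilter.em U fun u => ((ε / 2 : ℝ≥0) : ℝ≥0∞) < S.phi (S.traj x u) with hA | hB
  · refine hfree (ε / 2) (half_pos hε) hε2 (hsub _ ?_)
    refine mem_limitSet_of_tendsto (l := (U : Filter ℝ≥0)) (u := fun u => u + ε / 2)
      (tendsto_atTop_mono (fun u => le_self_add) hU) ?_
    have hc : Continuous fun z : X => S.flow (ε / 2) z :=
      S.flow.continuous continuous_const continuous_id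
    refine ((hc.tendsto p).comp hUp).congr' ?_
    filter_upwards [hA] with u hu
    rw [← S.traj_traj hS.global, S.traj_of_lt_phi hu]
    rfl
  · set r : ℝ≥0 → ℝ≥0 := fun u => (S.phi (S.traj x u)).toNNReal with hr
    have hfin : ∀ᶠ u in (U : Filter ℝ≥0), S.phi (S.traj x u) ≠ ∞ := by
      filter_upwards [hB] with u hu
      exact ne_top_of_le_ne_top ENNReal.coe_ne_top (not_lt.1 hu)
    have hIcc : ∀ᶠ u in (U : Filter ℝ≥0), r u ∈ Icc 0 (ε / 2) := by
      filter_upwards [hB, hfin] with u hu hu'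
      refine ⟨zero_le, ?_⟩
      rw [← ENNReal.coe_le_coe, hr, ENNReal.coe_toNNReal hu']
      exact not_lt.1 hu
    obtain ⟨r₀, hr₀, hlim⟩ := isCompact_Icc.ultrafilter_le_nhds' (U.map r) hIcc
    replace hlim : Tendsto r U (𝓝 r₀) := hlim
    have hmem : ∀ᶠ u in (U : Filter ℝ≥0), S.flow (r u) (S.traj x u) ∈ S.M := by
      filter_upwards [hfin] with u hu using S.flow_phi_mem hu
    have hflow : Tendsto (fun u => S.flow (r u) (S.traj x u)) U (𝓝 (S.flow r₀ p)) :=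
      (S.flow.cont'.tendsto (r₀, p)).comp (hlim.prodMk_nhds hUp)
    have hM : S.flow r₀ p ∈ S.M := S.isClosed.mem_of_tendsto hflow hmem
    have hzero : r₀ = 0 := by
      by_contra hne
      exact hfree r₀ (pos_iff_ne_zero.2 hne) (hr₀.2.trans_lt hε2) hM
    rw [hzero, Flow.map_zero_apply] at hflow hM
    have hI : Tendsto (fun u => S.I (S.flow (r u) (S.traj x u))) U (𝓝 (S.I p)) :=
      (S.continuousOn p hM).tendsto.comp (tendsto_nhdsWithin_iff.2 ⟨hflow, hmem⟩)
    have hIL : S.I p ∈ S.limitSet x := by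
      refine mem_limitSet_of_tendsto (l := (U : Filter ℝ≥0)) (u := fun u => u + r u)
        (tendsto_atTop_mono (fun u => le_self_add) hU) (hI.congr' ?_)
      filter_upwards [hfin] with u hu
      rw [← S.traj_traj hS.global, S.traj_phi hu]
    have : S.I p ∈ S.M ∩ S.I '' S.M := ⟨hsub _ hIL, p, hM, rfl⟩
    rw [hS.disjoint] at this
    exact this

theorem AsymptoticTo.limitSet_subset {x p : X} (hxp : S.AsymptoticTo x p) :
    S.limitSet p ⊆ S.limitSet x := by
  obtain ⟨g, -, hlim⟩ := hxp
  rintro z ⟨u, hu, hz⟩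
  have hv : Tendsto (fun n => g.symm (u n)) atTop atTop := g.symm.tendsto_nnreal_atTop.comp hu
  refine ⟨_, hv, ?_⟩
  have h1 := hlim.comp hv
  refine (tendsto_iff_of_dist (h1.congr fun n => ?_)).2 hz
  simp

theorem AsymptoticTo.limitSet_subset_closure {x p : X} (hxp : S.AsymptoticTo x p)
    (hS : ∀ x, S.lifetime x = ∞) : S.limitSet x ⊆ closure (S.orbit p) := by
  obtain ⟨g, -, hlim⟩ := hxp
  rintro z ⟨u, hu, hz⟩
  refine mem_closure_of_tendsto (f := fun n => S.traj p (g (u n)))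
    ((tendsto_iff_of_dist (hlim.comp hu)).1 hz)
    (Eventually.of_forall fun n => traj_mem_orbit hS p _)

/-- A pure shift of time would not fix `0`, so the reparametrization is corrected near the origin.
-/
theorem AsymptoticTo.traj_right (hS : ∀ x, S.lifetime x = ∞) {x p : X}
    (hxp : S.AsymptoticTo x p) (s : ℝ≥0) : S.AsymptoticTo x (S.traj p s) := by
  obtain ⟨g, hg0, hlim⟩ := hxp
  refine ⟨g.trans (shiftHomeomorph s), by simp [hg0, shiftHomeomorph_zero], hlim.congr' ?_⟩
  filter_upwards [g.tendsto_nnreal_atTop.eventually_ge_atTop (2 * s)] with t ht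
  have hs : s ≤ g t := le_trans (by rw [two_mul]; exact le_self_add) ht
  rw [S.traj_traj hS, Homeomorph.trans_apply, shiftHomeomorph_of_le ht, add_tsub_cancel_of_le hs]

theorem IsAlmostPeriodic.traj (hS : ∀ x, S.lifetime x = ∞) {p : X}
    (hp : S.IsAlmostPeriodic p) (s : ℝ≥0) : S.IsAlmostPeriodic (S.traj p s) := by
  intro ε hε
  obtain ⟨T, hT, h⟩ := hp ε hε
  refine ⟨T, hT, fun α => ?_⟩
  obtain ⟨τ, hτ, hτ0, hd⟩ := h α
  refine ⟨τ, hτ, hτ0, fun t => ?_⟩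
  rw [S.traj_traj hS, S.traj_traj hS, ← add_assoc]
  exact hd _

/-- Almost periods `τ n ≥ n` with error below `1 / (n + 1)` bring the motion back to each of its
points. -/
theorem IsAlmostPeriodic.traj_mem_limitSet {p : X} (hp : S.IsAlmostPeriodic p) (s : ℝ≥0) :
    S.traj p s ∈ S.limitSet p := by
  have key : ∀ n : ℕ, ∃ τ : ℝ≥0, (n : ℝ≥0) ≤ τ ∧
      dist (S.traj p (s + τ)) (S.traj p s) < 1 / ((n : ℝ) + 1) := fun n => by
    obtain ⟨T, -, h⟩ := hp (1 / ((n : ℝ) + 1)) (by positivity)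
    obtain ⟨τ, hτ, -, hd⟩ := h n
    exact ⟨τ, hτ.1, hd s⟩
  choose τ hτ hd using key
  refine ⟨fun n => s + τ n, tendsto_atTop_mono (fun n => (hτ n).trans le_add_self)
    tendsto_natCast_atTop_atTop, ?_⟩
  rw [tendsto_iff_dist_tendsto_zero]
  exact squeeze_zero (fun n => dist_nonneg) (fun n => (hd n).le)
    tendsto_one_div_add_atTop_nhds_zero_nat

theorem IsPeriodic.isAlmostPeriodic (hS : ∀ x, S.lifetime x = ∞) {p : X} (hp : S.IsPeriodic p) :
    S.IsAlmostPeriodic p := by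
  obtain ⟨τ, hτ, h⟩ := hp
  have hn : ∀ n : ℕ, S.traj p (n * τ) = p := by
    intro n
    induction n with
    | zero => simp [S.traj_zero]
    | succ n ih =>
      push_cast
      rw [add_mul, one_mul, ← S.traj_traj hS, ih, h]
  intro ε hε
  -- The first multiple of `τ` beyond `α`; adding `1` to the floor keeps it positive when `α < τ`.
  refine ⟨τ, hτ, fun α => ⟨((⌊α / τ⌋₊ + 1 : ℕ) : ℝ≥0) * τ, ⟨?_, ?_⟩, by positivity, fun t => ?_⟩⟩
  · have := (Nat.lt_floor_add_one (α / τ)).le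
    rw [div_le_iff₀ hτ] at this
    exact_mod_cast this
  · have := Nat.floor_le (zero_le : 0 ≤ α / τ)
    rw [le_div_iff₀ hτ] at this
    push_cast
    rw [add_mul, one_mul]
    gcongr
  · rw [add_comm, ← S.traj_traj hS, hn, dist_self]
    exact hε

theorem IsStationary.isPeriodic {p : X} (hp : S.IsStationary p) : S.IsPeriodic p :=
  ⟨1, one_pos, hp 1⟩

/-! ### Lifting the limit motion and the main theorem. -/

/-- The limit trajectory of `y` lifts to a limit trajectory of `x`. -/
theorem exists_lift_of_isAlmostPeriodic {Y : Type*} [MetricSpace Y] {R : ImpulsiveSystem Y}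
    (hS : S.Standing) (hR : R.Standing) {h : X → Y} (hh : IsIHomomorphism S R h) {y q : Y} {x : X}
    (hxy : h x = y) (hxM : x ∉ S.M) (hcompact : IsCompact (closure (S.orbit x)))
    (hunique : ∀ q ∈ R.limitSet y, ∃! p : X, h p = q)
    (hq : R.IsAlmostPeriodic q) (hyq : R.AsymptoticTo y q) :
    ∃ s p, S.AsymptoticTo x p ∧ S.IsAlmostPeriodic p ∧
      (∀ t, h (S.traj p t) = R.traj q (s + t)) ∧
      ∀ t t', R.traj q (s + t) = R.traj q (s + t') → S.traj p t = S.traj p t' := by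
  have hmapx : ∀ t, h (S.traj x t) = R.traj y t := fun t => by rw [hh.map_traj x hxM, hxy]
  have hmapL : ∀ z ∈ S.limitSet x, h z ∈ R.limitSet y := by
    rintro z ⟨u, hu, hz⟩
    exact ⟨u, hu, (((hh.continuous.tendsto z).comp hz).congr fun n => hmapx _)⟩
  have hinj : ∀ a b, h a ∈ R.limitSet y → h a = h b → a = b := fun a b ha hab =>
    (hunique _ ha).unique rfl hab.symm
  have hlift : ∀ z, h z ∈ R.limitSet y → z ∈ S.limitSet x := by
    intro z hz
    obtain ⟨u, hu, hlim⟩ := hz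
    obtain ⟨z', -, φ, hφ, hz'⟩ := hcompact.tendsto_subseq (x := fun n => S.traj x (u n))
      fun n => subset_closure (traj_mem_orbit hS.global x _)
    have hz'L : z' ∈ S.limitSet x := ⟨_, hu.comp hφ.tendsto_atTop, hz'⟩
    have heq : h z' = h z := tendsto_nhds_unique
      (((hh.continuous.tendsto z').comp hz').congr fun n => hmapx _)
      (hlim.comp hφ.tendsto_atTop)
    rwa [← hinj z' z (hmapL _ hz'L) heq]
  have hqL : ∀ s, R.traj q s ∈ R.limitSet y := fun s =>
    hyq.limitSet_subset (hq.traj_mem_limitSet s)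
  have hsubK := limitSet_subset_closure_orbit hS.global x
  have hclosed := isClosed_limitSet (S := S) x
  -- Points of the limit set are uniformly controlled by their images.
  have hunif : Tendsto (fun z : X × X => dist z.1 z.2)
      (comap (fun z : X × X => dist (h z.1) (h z.2)) (𝓝 0) ⊓
        𝓟 (S.limitSet x ×ˢ S.limitSet x)) (𝓝 0) := by
    refine tendsto_dist_of_tendsto_dist_map hh.continuous hcompact
      (a := Prod.fst) (b := Prod.snd) ?_ ?_ ?_ ?_
    · exact eventually_inf_principal.2 (Eventually.of_forall fun z hz => hsubK hz.1)
    · exact eventually_inf_principal.2 (Eventually.of_forall fun z hz => hsubK hz.2)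
    · exact tendsto_comap.mono_left inf_le_left
    · intro z hz z' hzz'
      refine hinj z z' (hmapL z ?_) hzz'
      refine isClosed_iff_clusterPt.1 hclosed z (hz.clusterPt.mono ?_)
      rw [le_principal_iff, mem_map]
      exact mem_inf_of_right (mem_principal.2 fun z hz => hz.1)
  obtain ⟨p₀, hp₀, -⟩ := hunique _ (hqL 0)
  obtain ⟨z, hzL, hzM⟩ := exists_mem_limitSet_notMem hS
    (hlift p₀ (by rw [hp₀]; exact hqL 0))
  -- If all lifts of the trajectory of `q` lay in the closed set `S.M`, so would their limit `z`: `h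
  -- z` is a limit of points of that trajectory, and `hunif` lifts the convergence.
  obtain ⟨s, p, hps, hpM⟩ : ∃ s p, h p = R.traj q s ∧ p ∉ S.M := by
    by_contra! hall
    apply hzM
    obtain ⟨w, hw, hwlim⟩ := mem_closure_iff_seq_limit.1
      (hyq.limitSet_subset_closure hR.global (hmapL z hzL))
    choose v _ hv using hw
    choose k hk _ using fun n => hunique _ (hqL (v n))
    have hd : Tendsto (fun n => dist z (k n)) atTop (𝓝 0) := by
      have hpair : Tendsto (fun n => (z, k n)) atTop
          (comap (fun z : X × X => dist (h z.1) (h z.2)) (𝓝 0) ⊓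
            𝓟 (S.limitSet x ×ˢ S.limitSet x)) := by
        refine tendsto_inf.2 ⟨tendsto_comap_iff.2 ?_, tendsto_principal.2 ?_⟩
        · simpa [Function.comp_def, hk, hv, dist_comm] using tendsto_iff_dist_tendsto_zero.1 hwlim
        · exact Eventually.of_forall fun n =>
            ⟨hzL, hlift _ (by rw [hk]; exact hqL _)⟩
      exact hunif.comp hpair
    refine S.isClosed.mem_of_tendsto (f := k) (b := atTop) ?_
      (Eventually.of_forall fun n => hall (v n) (k n) (hk n))
    rw [tendsto_iff_dist_tendsto_zero]
    simpa [dist_comm] using hd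
  have hmapp : ∀ t, h (S.traj p t) = R.traj q (s + t) := fun t => by
    rw [hh.map_traj p hpM, hps, R.traj_traj hR.global]
  have hpL : ∀ t, S.traj p t ∈ S.limitSet x := fun t => hlift _ (by rw [hmapp]; exact hqL _)
  refine ⟨s, p, ?_, ?_, hmapp, fun t t' htt' => ?_⟩
  · obtain ⟨g, hg0, hlim⟩ := hyq.traj_right hR.global s
    refine ⟨g, hg0, ?_⟩
    refine tendsto_dist_of_tendsto_dist_map hh.continuous hcompact
      (Eventually.of_forall fun t => subset_closure (traj_mem_orbit hS.global x t))
      (Eventually.of_forall fun t => hsubK (hpL _)) (hlim.congr fun t => ?_)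
      fun z hz z' hzz' => hinj z z' (hmapL z (mem_limitSet_iff.2 hz)) hzz'
    rw [hmapx, hmapp, R.traj_traj hR.global]
  · intro ε hε
    have hev := hunif.eventually (gt_mem_nhds hε)
    rw [eventually_inf_principal, eventually_comap] at hev
    obtain ⟨δ, hδ, hball⟩ := Metric.eventually_nhds_iff.1 hev
    obtain ⟨T, hT, hap⟩ := hq.traj hR.global s δ hδ
    refine ⟨T, hT, fun α => ?_⟩
    obtain ⟨τ, hτ, hτ0, hd⟩ := hap α
    refine ⟨τ, hτ, hτ0, fun t => ?_⟩
    have hd' := hd t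
    rw [R.traj_traj hR.global, R.traj_traj hR.global, ← hmapp, ← hmapp] at hd'
    refine hball (y := dist (h (S.traj p (t + τ))) (h (S.traj p t))) ?_
      (S.traj p (t + τ), S.traj p t) rfl ⟨hpL _, hpL _⟩
    simpa using hd'
  · exact hinj _ _ (by rw [hmapp]; exact hqL _) (by rw [hmapp, hmapp, htt'])

end ImpulsiveSystem

theorem mainTheorem9 {X Y : Type*} [MetricSpace X] [MetricSpace Y] [CompleteSpace Y]
    (S : ImpulsiveSystem X) (R : ImpulsiveSystem Y) (hS : S.Standing) (hR : R.Standing)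
    (h : X → Y) (hh : ImpulsiveSystem.IsIHomomorphism S R h)
    (y : Y) (x : X) (hx : x ∈ h ⁻¹' {y} \ S.M)
    (hcompact : IsCompact (closure (S.orbit x)))
    (hunique : ∀ q ∈ R.limitSet y, ∃! p : X, h p = q) :
    (R.IsAsympAlmostPeriodic y → S.IsAsympAlmostPeriodic x) ∧
    (R.IsAsympStationary y → S.IsAsympStationary x) ∧
    (R.IsAsympPeriodic y → S.IsAsympPeriodic x) := by
  refine ⟨?_, ?_, ?_⟩
  · rintro ⟨q, hq, hyq⟩
    obtain ⟨s, p, hxp, hp, -⟩ := ImpulsiveSystem.exists_lift_of_isAlmostPeriodic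
      hS hR hh hx.1 hx.2 hcompact hunique hq hyq
    exact ⟨p, hp, hxp⟩
  · rintro ⟨q, hq, hyq⟩
    obtain ⟨s, p, hxp, -, -, hp⟩ := ImpulsiveSystem.exists_lift_of_isAlmostPeriodic
      hS hR hh hx.1 hx.2 hcompact hunique (hq.isPeriodic.isAlmostPeriodic hR.global) hyq
    exact ⟨p, fun t => (hp t 0 (by rw [hq, hq])).trans (S.traj_zero p), hxp⟩
  · rintro ⟨q, hq, hyq⟩
    obtain ⟨s, p, hxp, -, -, hp⟩ := ImpulsiveSystem.exists_lift_of_isAlmostPeriodic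
      hS hR hh hx.1 hx.2 hcompact hunique (hq.isAlmostPeriodic hR.global) hyq
    obtain ⟨τ, hτ, hper⟩ := hq
    -- A period of `q` is also one at its later point `R.traj q s`, over which `p` lies.
    refine ⟨p, ⟨τ, hτ, (hp τ 0 ?_).trans (S.traj_zero p)⟩, hxp⟩
    rw [add_zero, add_comm, ← R.traj_traj hR.global, hper]
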